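/- Let $K$ be a field with $\operatorname{char} K\neq 2$, let $X$ be a well-ordered set with at least five elements (for example $X=\{x_1<\dots<x_m\}$ with $m\ge 5$, or $X=\{x_1<x_2<\cdots\}$), and let $x_1<x_2<x_3<x_4<x_5$ be its five smallest elements. Let $K\langle X\rangle$ be the free unitary associative algebra, $[f,g]=fg-gf$, and order the words in $X$ by the deg-lex ordering (first by length, then lexicographically from left to right). For nonzero $f$ let $\operatorname{lt}(f)$ be the greatest word occurring in $f$. A subset $B$ of a two-sided ideal $I$ is a Gröbner basis of $I$ if for every nonzero $f\in I$ there is a nonzero $g\in B$ such that $\operatorname{lt}(g)$ is a subword (contiguous factor) of $\operatorname{lt}(f)$; it is minimal if no $B\setminus\{g\}$ with $g\in B$ is a Gröbner basis of $I$. If $S$ is a semigroup of endomorphisms of $K\langle X\rangle$ and $I$ is invariant under $S$, then $G\subseteq I$ is a Gröbner $S$-basis of $I$ if $S(G)=\{\varphi(g)\mid \varphi\in S,\ g\in G\}$ is a Gröbner basis of $I$. Let $S$ be the subsemigroup of $\operatorname{End}(K\langle X\rangle)$ generated by all endomorphisms that send each of $x_1,x_2,x_3,x_4$ to an element of $X$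 (repetitions allowed) and $x_5$ to a product $y_1^{a_1}\cdots y_m^{a_m}$ with $m\ge 0$, $y_1<\dots<y_m$ in $X$ and $a_i\ge 0$, with no condition on the images of the other variables. Let $T$ be the T-ideal of $K\langle X\rangle$ generated by $[[x_1,x_2],x_3]$, i.e. the smallest two-sided ideal that contains this polynomial and is invariant under all endomorphisms of the algebra $K\langle X\rangle$. Then the set $G$ of the two polynomials $$[[x_1,x_2],x_3],\qquad [x_1,x_2]x_5[x_3,x_4]+[x_1,x_3]x_5[x_2,x_4]$$ is a Gröbner $S$-basis of $T$ with respect to the deg-lex ordering. The Gröbner basis $S(G)$ of $T$ is not minimal, and neither is $S(G)\setminus\{0\}$. -/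

import Mathlib

/-! Gröbner `S`-bases of ideals of the free unitary associative algebra `K⟨X⟩ = FreeAlgebra K X`.
Words in the alphabet `X` are the elements of `FreeMonoid X`. -/

namespace GroebnerS

section Words

variable {X : Type*}

/-- The deg-lex order on words over an ordered alphabet: words are compared by length first, and
words of the same length are compared lexicographically from left to right. -/
def DegLex [LinearOrder X] (u v : FreeMonoid X) : Prop :=
  List.Shortlex (fun a b : X => a < b) u.toList v.toList

/-- `u` is a subword (a contiguous factor) of `v`. -/
def IsSubword (u v : FreeMonoid X) : Prop :=
  ∃ a b : FreeMonoid X, v = a * u * b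

end Words

section Algebra

variable {K X : Type*} [Field K]

/-- The finite set of words that occur with a nonzero coefficient in `f`. -/
noncomputable def words (f : FreeAlgebra K X) : Finset (FreeMonoid X) :=
  (FreeAlgebra.equivMonoidAlgebraFreeMonoid f).coeff.support

/-- `w` is the leading word `lt(f)` of `f` for the strict term-ordering `r`: it occurs in `f`, and
all the other words of `f` are smaller. (No word is a leading word of `0`.) -/
def IsLeadingWord (r : FreeMonoid X → FreeMonoid X → Prop) (f : FreeAlgebra K X)
    (w : FreeMonoid X) : Prop :=
  w ∈ words f ∧ ∀ v ∈ words f, v ≠ w → r v w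

/-- `G` is a Gröbner basis of the two-sided ideal `I` for the term-ordering `r`: `G ⊆ I`, and for
every nonzero `f ∈ I` there is `g ∈ G` such that `lt(g)` is a subword of `lt(f)`. -/
def IsGroebnerBasis (r : FreeMonoid X → FreeMonoid X → Prop)
    (I : TwoSidedIdeal (FreeAlgebra K X)) (G : Set (FreeAlgebra K X)) : Prop :=
  (∀ g ∈ G, g ∈ I) ∧
    ∀ f ∈ I, f ≠ 0 → ∃ g ∈ G, ∃ u v : FreeMonoid X,
      IsLeadingWord r g u ∧ IsLeadingWord r f v ∧ IsSubword u v

/-- `G` is a minimal Gröbner basis of `I`: it is a Gröbner basis of `I`, and it ceases to be one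
when any single element is removed. -/
def IsMinimalGroebnerBasis (r : FreeMonoid X → FreeMonoid X → Prop)
    (I : TwoSidedIdeal (FreeAlgebra K X)) (G : Set (FreeAlgebra K X)) : Prop :=
  IsGroebnerBasis r I G ∧ ∀ g ∈ G, ¬ IsGroebnerBasis r I (G \ {g})

/-- The set `S(G)` of the images of the elements of `G` under the endomorphisms in `S`. -/
def endImage (S : Submonoid (FreeAlgebra K X →ₐ[K] FreeAlgebra K X))
    (G : Set (FreeAlgebra K X)) : Set (FreeAlgebra K X) :=
  {h | ∃ φ ∈ S, ∃ g ∈ G, φ g = h}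

/-- `I` is an `S`-ideal: it is invariant under all the endomorphisms in `S`. -/
def IsSIdeal (S : Submonoid (FreeAlgebra K X →ₐ[K] FreeAlgebra K X))
    (I : TwoSidedIdeal (FreeAlgebra K X)) : Prop :=
  ∀ φ ∈ S, ∀ f ∈ I, φ f ∈ I

/-- `G` is a Gröbner `S`-basis of `I`: `I` is an `S`-ideal, `G ⊆ I`, and `S(G)` is a Gröbner basis
of the two-sided ideal `I`. -/
def IsGroebnerSBasis (r : FreeMonoid X → FreeMonoid X → Prop)
    (S : Submonoid (FreeAlgebra K X →ₐ[K] FreeAlgebra K X))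
    (I : TwoSidedIdeal (FreeAlgebra K X)) (G : Set (FreeAlgebra K X)) : Prop :=
  IsSIdeal S I ∧ (∀ g ∈ G, g ∈ I) ∧ IsGroebnerBasis r I (endImage S G)

/-- The T-ideal generated by `U`: the two-sided ideal generated by the images of the elements of
`U` under all the endomorphisms of `K⟨X⟩`. -/
def tIdeal (U : Set (FreeAlgebra K X)) : TwoSidedIdeal (FreeAlgebra K X) :=
  TwoSidedIdeal.span (endImage ⊤ U)

theorem subset_tIdeal (U : Set (FreeAlgebra K X)) : ∀ f ∈ U, f ∈ tIdeal U := fun f hf =>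
  TwoSidedIdeal.subset_span ⟨1, trivial, f, hf, rfl⟩

/-- The T-ideal generated by `U` is invariant under all endomorphisms. -/
theorem isSIdeal_tIdeal (U : Set (FreeAlgebra K X)) : IsSIdeal ⊤ (tIdeal U) := by
  intro φ _ f hf
  have h : tIdeal U ≤ (tIdeal U).comap φ := by
    refine TwoSidedIdeal.span_le.2 ?_
    rintro _ ⟨ψ, -, g, hg, rfl⟩
    exact (TwoSidedIdeal.mem_comap φ).2
      (TwoSidedIdeal.subset_span ⟨φ * ψ, trivial, g, hg, rfl⟩)
  exact (TwoSidedIdeal.mem_comap φ).1 (h hf)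

/-- The T-ideal generated by `U` is the smallest two-sided ideal that contains `U` and is
invariant under all endomorphisms. -/
theorem tIdeal_le (U : Set (FreeAlgebra K X)) (I : TwoSidedIdeal (FreeAlgebra K X))
    (hU : ∀ f ∈ U, f ∈ I) (hI : IsSIdeal ⊤ I) : tIdeal U ≤ I := by
  refine TwoSidedIdeal.span_le.2 ?_
  rintro _ ⟨ψ, -, g, hg, rfl⟩
  exact hI ψ trivial g (hU g hg)

/-- The monomials `x₁^a₁ ⋯ xₘ^aₘ` with `x₁ < ⋯ < xₘ` and `aᵢ ≥ 0`, that is, the products of finite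
non-decreasing (possibly empty) sequences of variables. -/
def IsOrderedMonomial [LinearOrder X] (f : FreeAlgebra K X) : Prop :=
  ∃ l : List X, l.Pairwise (fun a b => a ≤ b) ∧ f = (l.map (FreeAlgebra.ι K)).prod

/-- The semigroup `S` generated by all the endomorphisms of `K⟨X⟩` that send the variables
`x 0, x 1, x 2, x 3` to elements of `X` and `x 4` to an ordered monomial. The identity is one of
these endomorphisms, so the generated submonoid is the generated subsemigroup. -/
def grassmannSemigroup (K : Type*) {X : Type*} [Field K] [LinearOrder X] (x : Fin 5 → X) :
    Submonoid (FreeAlgebra K X →ₐ[K] FreeAlgebra K X) :=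
  Submonoid.closure {φ |
    (∀ i : Fin 5, i ≠ 4 → ∃ y : X, φ (FreeAlgebra.ι K (x i)) = FreeAlgebra.ι K y) ∧
      IsOrderedMonomial (φ (FreeAlgebra.ι K (x 4)))}

/-- The polynomial `[[y₁, y₂], y₃]`. -/
def tripleComm (y₁ y₂ y₃ : FreeAlgebra K X) : FreeAlgebra K X :=
  ⁅⁅y₁, y₂⁆, y₃⁆

/-- The polynomial `[y₁, y₂] y₅ [y₃, y₄] + [y₁, y₃] y₅ [y₂, y₄]`. -/
def latyshevPoly (y₁ y₂ y₃ y₄ y₅ : FreeAlgebra K X) : FreeAlgebra K X :=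
  ⁅y₁, y₂⁆ * y₅ * ⁅y₃, y₄⁆ + ⁅y₁, y₃⁆ * y₅ * ⁅y₂, y₄⁆

end Algebra

end GroebnerS

/-! A set of elements of `T` is a Gröbner basis once every word that leads an element of `T`
contains one of their leading words. The leading words needed here are the factors collected in
`HasObstruction`, and a word without obstruction is normal: a non-decreasing word with some descents
`b a` whose letters satisfy `a₁ < b₁ < a₂ < b₂ < ⋯`. It remains to show that no normal word leads an
element of `T`.

For each normal word `w` there is a linear functional that kills `T` and all words smaller than `w`,
but not `w` (`exists_functional`). It is a matrix coefficient of a representation on functions of an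
exponent vector and a set of anticommuting variables. The letter `j` acts by `t j + ∑ D k * (e k * e
j)`, `k > j`, and `lie_lie_lift_eq_zero` shows that this action satisfies `[[f, g], h] = 0`.

Read from left to right, a letter either joins the exponent vector or takes an earlier, greater
letter out of it, and both enter the anticommuting set. A normal word reaches its final
configuration by pairing each `a` with the `b` just before it; a lexicographically smaller
rearrangement leaves some required letter unpaired (`IsNormalSuffix.wordOp_apply`). -/

namespace GroebnerS

/-! ### A criterion for the identity `[[f, g], h] = 0` -/

section RingIdentity

/-- If `R i` are elements of an algebra, `d` squares to zero, the commutators `e i = [d, R i]`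
commute with all `R j`, and `[R i, R j] = e i * e j`, then the subalgebra generated by the `R i`
satisfies the identity `[[f, g], h] = 0`. -/
theorem lie_lie_lift_eq_zero {K A X : Type*} [Field K] [Ring A] [Algebra K A] (d : A) (R e : X → A)
    (hd : d * d = 0) (he : ∀ i, d * R i - R i * d = e i) (heR : ∀ i j, e i * R j = R j * e i)
    (hR : ∀ i j, R i * R j - R j * R i = e i * e j) (f g h : FreeAlgebra K X) :
    FreeAlgebra.lift K R ⁅⁅f, g⁆, h⁆ = 0 := by
  set L := FreeAlgebra.lift K R with hL
  have hLi : ∀ i, L (FreeAlgebra.ι K i) = R i := fun i => by simp [hL]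
  have hde : ∀ i, d * e i = - (e i * d) := fun i => by
    rw [← he]; linear_combination (norm := noncomm_ring) hd * R i - R i * hd
  have heg : ∀ i g, e i * L g = L g * e i := by
    intro i g
    induction g using FreeAlgebra.induction with
    | grade0 r => rw [AlgHom.commutes, Algebra.commutes]
    | grade1 x => rw [hLi, heR]
    | mul a b ha hb => rw [map_mul, ← mul_assoc, ha, mul_assoc, hb, mul_assoc]
    | add a b ha hb => rw [map_add, mul_add, ha, hb, add_mul]
  -- Both sides are derivations in `g`, because `e i` commutes with the image of `L`; so generators
  -- suffice.
  have hRg : ∀ i g, R i * L g - L g * R i = e i * (d * L g - L g * d) := by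
    intro i g
    induction g using FreeAlgebra.induction with
    | grade0 r => rw [AlgHom.commutes, Algebra.commutes, Algebra.commutes r d]; simp
    | grade1 x => rw [hLi, hR, he]
    | mul a b ha hb =>
      rw [map_mul]
      linear_combination (norm := noncomm_ring) ha * L b + L a * hb
        - heg i a * (d * L b - L b * d)
    | add a b ha hb =>
      rw [map_add]
      linear_combination (norm := noncomm_ring) ha + hb
  -- Take the commutator of `hRg` with `d`. The right side vanishes, since `d` anticommutes with `e
  -- i` and, by `d * d = 0`, with `[d, L g]`; the left side leaves `[R i, [d, L g]]`.
  have hdR : ∀ i g, (d * L g - L g * d) * R i = R i * (d * L g - L g * d) := by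
    intro i g
    have h1 := hRg i g
    have h2 := heg i g
    have h3 := hde i
    have h4 := he i
    linear_combination (norm := noncomm_ring) h1 * d - d * h1 + h4 * L g - L g * h4 + h2
      - h3 * (d * L g - L g * d) + e i * hd * L g - e i * L g * hd
  have hdg : ∀ f g, (d * L g - L g * d) * L f = L f * (d * L g - L g * d) := by
    intro f g
    induction f using FreeAlgebra.induction with
    | grade0 r => rw [AlgHom.commutes, Algebra.commutes]
    | grade1 x => rw [hLi, hdR]
    | mul a b ha hb => rw [map_mul, ← mul_assoc, ha, mul_assoc, hb, mul_assoc]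
    | add a b ha hb => rw [map_add, mul_add, ha, hb, add_mul]
  have hfg : ∀ f g, L f * L g - L g * L f = (d * L f - L f * d) * (d * L g - L g * d) := by
    intro f g
    induction f using FreeAlgebra.induction with
    | grade0 r =>
      rw [AlgHom.commutes, Algebra.commutes, Algebra.commutes r d]; simp
    | grade1 x => rw [hLi, hRg, he]
    | mul a b ha hb =>
      rw [map_mul]
      linear_combination (norm := noncomm_ring) ha * L b + L a * hb
        + (d * L a - L a * d) * hdg b g
    | add a b ha hb =>
      rw [map_add]
      linear_combination (norm := noncomm_ring) ha + hb
  simp only [Ring.lie_def, map_sub, map_mul, hfg]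
  linear_combination (norm := noncomm_ring)
    (d * L f - L f * d) * hdg h g + hdg h f * (d * L g - L g * d)

end RingIdentity

/-! ### Operators satisfying the criterion, from Heisenberg and exterior relations -/

section Relations

variable {X A : Type*} [LinearOrder X] [Ring A]

omit [LinearOrder X] in
theorem commute_mul_of_anticomm {e : X → A} (he : ∀ i j, e i * e j = -(e j * e i)) (i j k : X) :
    Commute (e i * e j) (e k) := by
  unfold Commute SemiconjBy
  rw [mul_assoc, he j k, mul_neg, ← mul_assoc, he i k, neg_mul, neg_neg, mul_assoc]

variable {t D e : X → A} (J : Finset X)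

/-- The element `t j + ∑ D k * (e k * e j)`, the sum over `k ∈ J` with `j < k`. -/
def twisted (t D e : X → A) (J : Finset X) (j : X) : A :=
  t j + ∑ k ∈ J with j < k, D k * (e k * e j)

/-- By the Heisenberg relation, the commutator with `t i` picks out the term `k = i`. -/
theorem commutator_sum (htD : ∀ i k, t i * D k - D k * t i = if i = k then 1 else 0)
    (s : Finset X) (i : X) (a : X → A)
    (hta : ∀ k, Commute (t i) (a k)) :
    t i * (∑ k ∈ s, D k * a k) - (∑ k ∈ s, D k * a k) * t i = if i ∈ s then a i else 0 := by
  rw [Finset.mul_sum, Finset.sum_mul, ← Finset.sum_sub_distrib]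
  have : ∀ k ∈ s, t i * (D k * a k) - D k * a k * t i = if i = k then a k else 0 := by
    intro k _
    rw [mul_assoc (D k), ← (hta k).eq, ← mul_assoc, ← mul_assoc, ← sub_mul, htD]
    split_ifs <;> simp
  rw [Finset.sum_congr rfl this, Finset.sum_ite_eq]

/-- The summands `D k * e k` square to zero and anticommute, so the cross terms cancel in pairs. -/
theorem sum_mul_sum_eq_zero (hDD : ∀ i k, Commute (D i) (D k))
    (hDe : ∀ i k, Commute (D i) (e k)) (he : ∀ i j, e i * e j = -(e j * e i))
    (he2 : ∀ i, e i * e i = 0) :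
    (∑ k ∈ J, D k * e k) * (∑ k ∈ J, D k * e k) = 0 := by
  classical
  induction J using Finset.induction_on with
  | empty => simp
  | insert a s ha ih =>
    rw [Finset.sum_insert ha, add_mul, mul_add, mul_add, ih, add_zero,
      Finset.mul_sum, Finset.sum_mul, add_assoc, ← Finset.sum_add_distrib]
    have h1 : D a * e a * (D a * e a) = 0 := by
      rw [mul_assoc, ← mul_assoc (e a), ← (hDe a a).eq, mul_assoc, he2]; simp
    rw [h1, zero_add]
    refine Finset.sum_eq_zero fun k _ => ?_
    rw [mul_assoc, ← mul_assoc (e a), ← (hDe k a).eq, mul_assoc (D k) (e k), ← mul_assoc (e k),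
      ← (hDe a k).eq, mul_assoc, mul_assoc, he k a, ← mul_assoc, ← mul_assoc, (hDD a k).eq,
      mul_neg, mul_neg, ← mul_assoc (D k), mul_assoc (D k * D a), add_neg_cancel]

/-- The products `e k * e j` are even, so the correction sums commute with each other, with all `e
i` and with `∑ D k * e k`; only commutators with `t` contribute. The condition `j < k` in the sum
makes exactly one of two distinct letters see the other, so `e i * e j` arises once. The finite `J`
keeps the sum finite when `X` is infinite. -/
theorem twisted_relations (htt : ∀ i k, Commute (t i) (t k)) (hDD : ∀ i k, Commute (D i) (D k))
    (htD : ∀ i k, t i * D k - D k * t i = if i = k then 1 else 0)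
    (hte : ∀ i k, Commute (t i) (e k)) (hDe : ∀ i k, Commute (D i) (e k))
    (he : ∀ i j, e i * e j = -(e j * e i)) (he2 : ∀ i, e i * e i = 0)
    (heJ : ∀ i, i ∉ J → e i = 0) :
    (∀ i, (∑ k ∈ J, D k * e k) * twisted t D e J i - twisted t D e J i * (∑ k ∈ J, D k * e k)
      = - e i) ∧
    (∀ i j, - e i * twisted t D e J j = twisted t D e J j * - e i) ∧
    (∀ i j, twisted t D e J i * twisted t D e J j - twisted t D e J j * twisted t D e J i
      = - e i * - e j) := by
  have hee := fun i j k => commute_mul_of_anticomm he i j k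
  have hQe : ∀ j i, Commute (∑ k ∈ J with j < k, D k * (e k * e j)) (e i) := fun j i =>
    Commute.sum_left _ _ _ fun k _ => (hDe k i).mul_left (hee k j i)
  have hQD : ∀ j i, Commute (∑ k ∈ J with j < k, D k * (e k * e j)) (D i) := fun j i =>
    Commute.sum_left _ _ _ fun k _ =>
      (hDD k i).mul_left (((hDe i k).symm).mul_left (hDe i j).symm)
  refine ⟨fun i => ?_, fun i j => ?_, ?_⟩
  · have h1 := commutator_sum htD J i e (hte i)
    have h2 : Commute (∑ k ∈ J with i < k, D k * (e k * e i)) (∑ k ∈ J, D k * e k) :=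
      Commute.sum_right _ _ _ fun k _ => (hQD i k).mul_right (hQe i k)
    have h3 : (if i ∈ J then e i else 0) = e i := by
      split_ifs with h
      · rfl
      · exact (heJ i h).symm
    rw [h3] at h1
    unfold twisted
    linear_combination (norm := noncomm_ring) -h1 - h2.eq
  · have : Commute (twisted t D e J j) (e i) := (hte j i).add_left (hQe j i)
    rw [neg_mul, mul_neg, this.eq]
  · have key : ∀ i j, j < i → twisted t D e J i * twisted t D e J j
        - twisted t D e J j * twisted t D e J i = e i * e j := by
      intro i j hij
      have h1 := commutator_sum htD (J.filter (j < ·)) i (fun k => e k * e j)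
        fun k => (hte i k).mul_right (hte i j)
      have h2 := commutator_sum htD (J.filter (i < ·)) j (fun k => e k * e i)
        fun k => (hte j k).mul_right (hte j i)
      have h3 : Commute (∑ k ∈ J with i < k, D k * (e k * e i))
          (∑ k ∈ J with j < k, D k * (e k * e j)) :=
        Commute.sum_right _ _ _ fun k _ =>
          (hQD i k).mul_right ((hQe i k).mul_right (hQe i j))
      have h4 : (if i ∈ J.filter (j < ·) then e i * e j else 0) = e i * e j := by
        by_cases h : i ∈ J
        · simp [h, hij]
        · simp [heJ i h]
      have h5 : (if j ∈ J.filter (i < ·) then e j * e i else 0) = 0 := by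
        simp [hij.le]
      rw [h4] at h1
      rw [h5] at h2
      unfold twisted
      linear_combination (norm := noncomm_ring) h1 - h2 + h3.eq + (htt i j).eq
    intro i j
    rw [neg_mul_neg]
    rcases lt_trichotomy j i with h | rfl | h
    · exact key i j h
    · rw [he2, sub_self]
    · rw [he, ← key j i h]; abel

end Relations

/-! ### The representation and its action on configurations -/

section Operators

variable (K : Type*) {X : Type*} [Field K] [LinearOrder X]

/-- Multiplication by a commuting variable, in the dual of `K[t] ⊗ Λ`: functions of an exponent
vector and a finite set of anticommuting variables. -/
def shiftOp (i : X) : Module.End K ((X → ℤ) × Finset X → K) where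
  toFun F c := F (c.1 + Pi.single i 1, c.2)
  map_add' _ _ := rfl
  map_smul' _ _ := rfl

/-- Differentiation with respect to a commuting variable. -/
def derivOp (i : X) : Module.End K ((X → ℤ) × Finset X → K) where
  toFun F c := (c.1 i : K) * F (c.1 - Pi.single i 1, c.2)
  map_add' _ _ := by ext; simp [mul_add]
  map_smul' _ _ := by ext; simp [mul_left_comm]

/-- Multiplication by the anticommuting variable `k` if `k ∈ J`, and zero otherwise. -/
def fermiOp (J : Finset X) (k : X) : Module.End K ((X → ℤ) × Finset X → K) where
  toFun F c := if k ∈ J ∧ k ∉ c.2 then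
    (-1) ^ (c.2.filter (· < k)).card * F (c.1, insert k c.2) else 0
  map_add' _ _ := by ext; simp only [Pi.add_apply]; split_ifs <;> simp [mul_add]
  map_smul' _ _ := by ext; simp [mul_left_comm]

variable {K}

theorem card_filter_insert_lt {S : Finset X} {i j : X} (hi : i ∉ S) :
    ((insert i S).filter (· < j)).card = (S.filter (· < j)).card + if i < j then 1 else 0 := by
  rw [Finset.filter_insert]
  split_ifs with h
  · rw [Finset.card_insert_of_notMem (by simp [hi])]
  · rfl

theorem fermiOp_mul_self (J : Finset X) (i : X) : fermiOp K J i * fermiOp K J i = 0 := by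
  refine LinearMap.ext fun F => funext fun c => ?_
  simp [fermiOp]

theorem fermiOp_anticomm (J : Finset X) (i j : X) :
    fermiOp K J i * fermiOp K J j = -(fermiOp K J j * fermiOp K J i) := by
  have key : ∀ i j, i < j → fermiOp K J i * fermiOp K J j = -(fermiOp K J j * fermiOp K J i) := by
    intro i j hij
    refine LinearMap.ext fun F => funext fun ⟨N, S⟩ => ?_
    simp only [Module.End.mul_apply, LinearMap.neg_apply, Pi.neg_apply, fermiOp, LinearMap.coe_mk,
      AddHom.coe_mk]
    by_cases hi : i ∈ J ∧ i ∉ S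
    · by_cases hj : j ∈ J ∧ j ∉ S
      -- Inserting the smaller `i` adds one to the count below `j`, while inserting `j` leaves the
      -- count below `i` alone: this is the sign.
      · rw [if_pos hi, if_pos hj, if_pos (by simp [hj, hij.ne']), if_pos (by simp [hi, hij.ne]),
          card_filter_insert_lt hi.2, card_filter_insert_lt hj.2, if_pos hij, if_neg hij.not_gt,
          Finset.insert_comm]
        ring
      · rw [if_neg hj, if_pos hi, if_neg (by simp only [Finset.mem_insert]; tauto)]
        simp
    · rw [if_neg hi]
      split_ifs
      · exfalso; simp only [Finset.mem_insert] at *; tauto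
      · simp
      · simp
  rcases lt_trichotomy i j with h | rfl | h
  · exact key i j h
  · simp [fermiOp_mul_self]
  · rw [key j i h, neg_neg]

theorem derivOp_commute (i k : X) : Commute (derivOp K i) (derivOp K k) := by
  refine LinearMap.ext fun F => funext fun c => ?_
  simp only [Module.End.mul_apply, derivOp, LinearMap.coe_mk, AddHom.coe_mk, Pi.sub_apply]
  rw [sub_right_comm]
  by_cases h : i = k
  · subst h; rfl
  · rw [Pi.single_eq_of_ne h, Pi.single_eq_of_ne (Ne.symm h)]
    simp [mul_left_comm]

theorem derivOp_commute_fermiOp (J : Finset X) (i k : X) :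
    Commute (derivOp K i) (fermiOp K J k) := by
  refine LinearMap.ext fun F => funext fun c => ?_
  simp only [Module.End.mul_apply, derivOp, fermiOp, LinearMap.coe_mk, AddHom.coe_mk]
  split_ifs <;> ring

/-- The operator by which a letter acts. -/
noncomputable def letterOp (K : Type*) [Field K] (J : Finset X) :
    X → Module.End K ((X → ℤ) × Finset X → K) :=
  twisted (shiftOp K) (derivOp K) (fermiOp K J) J

/-- The Heisenberg relation reads `[t, D] = 1` here, opposite to its form on polynomials, because
the operators act on the dual: `(N i + 1) - N i = 1`. -/
theorem lift_letterOp_lie_lie (J : Finset X) (f g h : FreeAlgebra K X) :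
    FreeAlgebra.lift K (letterOp K J) ⁅⁅f, g⁆, h⁆ = 0 := by
  have hR := twisted_relations (t := shiftOp K) (D := derivOp K) (e := fermiOp K J) J
    (fun i k => LinearMap.ext fun F => funext fun c => by
      simp only [Module.End.mul_apply, shiftOp, LinearMap.coe_mk, AddHom.coe_mk, add_right_comm])
    derivOp_commute
    (fun i k => LinearMap.ext fun F => funext fun c => by
      simp only [LinearMap.sub_apply, Pi.sub_apply, Module.End.mul_apply, derivOp, shiftOp,
        LinearMap.coe_mk, AddHom.coe_mk, Pi.add_apply]
      rw [sub_add_eq_add_sub]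
      split_ifs with h
      · subst h; simp; ring
      · rw [Pi.single_eq_of_ne (Ne.symm h)]; simp)
    (fun i k => LinearMap.ext fun F => funext fun c => rfl)
    (derivOp_commute_fermiOp J)
    (fermiOp_anticomm J) (fermiOp_mul_self J)
    (fun i hi => LinearMap.ext fun F => funext fun c => by simp [fermiOp, hi])
  exact lie_lie_lift_eq_zero _ _ (fun i => - fermiOp K J i)
    (sum_mul_sum_eq_zero J
      derivOp_commute
      (derivOp_commute_fermiOp J)
      (fermiOp_anticomm J) (fermiOp_mul_self J)) hR.1 hR.2.1 hR.2.2 f g h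

theorem letterOp_apply (J : Finset X) (j : X) (F : (X → ℤ) × Finset X → K) (N : X → ℤ)
    (S : Finset X) : letterOp K J j F (N, S) = F (N + Pi.single j 1, S) +
      ∑ k ∈ J with j < k, (N k : K) * (fermiOp K J k (fermiOp K J j F) (N - Pi.single k 1, S)) := by
  simp [letterOp, twisted, shiftOp, derivOp, Finset.sum_apply]

theorem fermiOp_fermiOp_apply (J : Finset X) (j k : X) (F : (X → ℤ) × Finset X → K) (N : X → ℤ)
    (S : Finset X) : ∃ ε : K, ε ≠ 0 ∧ fermiOp K J k (fermiOp K J j F) (N, S) =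
      if (k ∈ J ∧ k ∉ S) ∧ j ∈ J ∧ j ∉ insert k S then ε * F (N, insert j (insert k S)) else 0 := by
  refine ⟨(-1) ^ (S.filter (· < k)).card * (-1) ^ ((insert k S).filter (· < j)).card,
    by simp, ?_⟩
  simp only [fermiOp, LinearMap.coe_mk, AddHom.coe_mk]
  by_cases h1 : k ∈ J ∧ k ∉ S
  · by_cases h2 : j ∈ J ∧ j ∉ insert k S
    · rw [if_pos h1, if_pos h2, if_pos ⟨h1, h2⟩, mul_assoc]
    · rw [if_pos h1, if_neg h2, if_neg (by tauto), mul_zero]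
  · rw [if_neg h1, if_neg (by tauto)]

theorem letterOp_apply_of_forall {J : Finset X} {j : X} (F : (X → ℤ) × Finset X → K) {N : X → ℤ}
    {S : Finset X} (h : ∀ k ∈ J, k ∉ S → j < k → N k = 0) :
    letterOp K J j F (N, S) = F (N + Pi.single j 1, S) := by
  rw [letterOp_apply, Finset.sum_eq_zero, add_zero]
  intro k hk
  rw [Finset.mem_filter] at hk
  obtain ⟨ε, -, h1⟩ := fermiOp_fermiOp_apply J j k F (N - Pi.single k 1) S
  by_cases hS : k ∈ S
  · rw [h1, if_neg (by tauto), mul_zero]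
  · simp [h k hk.1 hS hk.2]

/-- The pairing of `j` with `b` carries the factor `N b`. Requiring `N b = 1` makes it a nonzero
scalar in every characteristic. -/
theorem letterOp_apply_of_unique {J : Finset X} {j b : X} (F : (X → ℤ) × Finset X → K)
    {N : X → ℤ} {S : Finset X} (h : ∀ k ∈ J, k ∉ S → j < k → k ≠ b → N k = 0)
    (hb : N b = 1) (hjb : j < b) (hbJ : b ∈ J) (hjJ : j ∈ J) (hbS : b ∉ S) (hjS : j ∉ S) :
    ∃ ε : K, ε ≠ 0 ∧ letterOp K J j F (N, S) =
      F (N + Pi.single j 1, S) + ε * F (N - Pi.single b 1, insert j (insert b S)) := by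
  obtain ⟨ε, hε, h2⟩ := fermiOp_fermiOp_apply J j b F (N - Pi.single b 1) S
  refine ⟨ε, hε, ?_⟩
  rw [letterOp_apply, Finset.sum_eq_single_of_mem b (by simp [hbJ, hjb]), h2, hb,
    if_pos ⟨⟨hbJ, hbS⟩, hjJ, by simp [hjb.ne, hjS]⟩, Int.cast_one, one_mul]
  intro k hk hkb
  rw [Finset.mem_filter] at hk
  obtain ⟨ε', -, h1⟩ := fermiOp_fermiOp_apply J j k F (N - Pi.single k 1) S
  by_cases hS : k ∈ S
  · rw [h1, if_neg (by tauto), mul_zero]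
  · simp [h k hk.1 hS hk.2 hkb]

theorem letterOp_apply_ne_zero {J : Finset X} {j : X} {F : (X → ℤ) × Finset X → K} {N : X → ℤ}
    {S : Finset X} (h : letterOp K J j F (N, S) ≠ 0) : F (N + Pi.single j 1, S) ≠ 0 ∨
      ∃ k, j < k ∧ k ∉ S ∧ j ∉ S ∧ F (N - Pi.single k 1, insert j (insert k S)) ≠ 0 := by
  by_contra! hc
  refine h ?_
  rw [letterOp_apply, hc.1, zero_add]
  refine Finset.sum_eq_zero fun k hk => ?_
  rw [Finset.mem_filter] at hk
  obtain ⟨ε, -, h1⟩ := fermiOp_fermiOp_apply J j k F (N - Pi.single k 1) S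
  rw [h1]
  split_ifs with h2
  · simp only [Finset.mem_insert, not_or] at h2
    rw [hc.2 k hk.2 h2.1.2 h2.2.2.2, mul_zero, mul_zero]
  · rw [mul_zero]

/-- The operator by which a word acts. -/
noncomputable def wordOp (K : Type*) [Field K] (J : Finset X) (v : List X) :
    Module.End K ((X → ℤ) × Finset X → K) :=
  (v.map (letterOp K J)).prod

theorem wordOp_cons (J : Finset X) (j : X) (v : List X) (F : (X → ℤ) × Finset X → K) :
    wordOp K J (j :: v) F = letterOp K J j (wordOp K J v F) := by
  simp [wordOp]

theorem wordOp_nil (J : Finset X) (F : (X → ℤ) × Finset X → K) : wordOp K J [] F = F := by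
  simp [wordOp]

/-- If all the letters of `v` are greater than `a`, then `v` does not change the set of
anticommuting variables below `a`. -/
theorem mem_iff_of_wordOp_ne_zero {J T : Finset X} {F : (X → ℤ) × Finset X → K} {a : X}
    (hF : ∀ N S, F (N, S) ≠ 0 → S = T) {v : List X} (hv : ∀ z ∈ v, a < z) :
    ∀ {N : X → ℤ} {S : Finset X}, wordOp K J v F (N, S) ≠ 0 → ∀ z ≤ a, (z ∈ S ↔ z ∈ T) := by
  induction v with
  | nil =>
    intro N S h z _
    rw [wordOp_nil] at h
    rw [hF N S h]
  | cons j v ih =>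
    intro N S h z hz
    simp only [List.mem_cons, forall_eq_or_imp] at hv
    rw [wordOp_cons] at h
    rcases letterOp_apply_ne_zero h with h | ⟨k, hjk, -, -, h⟩
    · exact ih hv.2 h z hz
    · rw [← ih hv.2 h z hz]
      have h1 : z ≠ j := (hz.trans_lt hv.1).ne
      have h2 : z ≠ k := (hz.trans_lt (hv.1.trans hjk)).ne
      simp [h1, h2]

/-- The content of a word is determined by the configurations it joins. -/
theorem content_of_wordOp_ne_zero {J T : Finset X} {F : (X → ℤ) × Finset X → K} {M : X → ℤ}
    (hF : ∀ N S, F (N, S) ≠ 0 → N = M ∧ S = T) {v : List X} :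
    ∀ {N : X → ℤ} {S : Finset X}, wordOp K J v F (N, S) ≠ 0 → ∀ z,
      N z + (if z ∈ S then 1 else 0) + v.count z = M z + if z ∈ T then 1 else 0 := by
  induction v with
  | nil =>
    intro N S h z
    rw [wordOp_nil] at h
    rw [(hF N S h).1, (hF N S h).2]; simp
  | cons j v ih =>
    intro N S h z
    rw [wordOp_cons] at h
    rcases letterOp_apply_ne_zero h with h | ⟨k, hjk, hkS, hjS, h⟩
    -- The letter joins the exponent vector; in the other case `k` moves from the exponent vector to
    -- the set, where `j` joins it. Both conserve the total content.
    · rw [← ih h z]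
      simp only [List.count_cons, Pi.add_apply, Pi.single_apply, beq_iff_eq, eq_comm (a := z)]
      push_cast
      ring
    · rw [← ih h z]
      simp only [List.count_cons, Pi.sub_apply, Pi.single_apply, beq_iff_eq, Finset.mem_insert]
      rcases eq_or_ne z j with rfl | h1
      · simp [hjk.ne, hjS]; ring
      · rcases eq_or_ne z k with rfl | h2
        · simp [hkS, h1, h1.symm]
        · simp [h1, h2, h1.symm]

end Operators

/-! ### Normal words and the functionals that detect them -/

section NormalWords

variable {X : Type*} [LinearOrder X]

/-- The suffixes of normal words: a normal word is a non-decreasing word in which some letters `b`,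
each greater than the letter before it, are followed by smaller letters `a`, such that these pairs
satisfy `a₁ < b₁ < a₂ < b₂ < ⋯`. Here `m` is the last letter of the non-decreasing word and `B` the
greatest of the letters of the pairs that precede the suffix, and `J` is the set of the letters of
the pairs of the suffix. -/
inductive IsNormalSuffix : WithBot X → WithBot X → List X → Finset X → Prop
  | nil (m B : WithBot X) : IsNormalSuffix m B [] ∅
  | cons {m B : WithBot X} {y : X} {w : List X} {J : Finset X} (hm : m ≤ y)
      (hw : IsNormalSuffix y B w J) : IsNormalSuffix m B (y :: w) J
  | pair {m B : WithBot X} {a b : X} {w : List X} {J : Finset X} (hm : m < b) (hB : B < a)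
      (hab : a < b) (hw : IsNormalSuffix b b w J) :
      IsNormalSuffix m B (b :: a :: w) (insert a (insert b J))

namespace IsNormalSuffix

variable {m B : WithBot X} {w : List X} {J : Finset X}

theorem lt_of_mem_pairs (h : IsNormalSuffix m B w J) : ∀ k ∈ J, B < k := by
  induction h with
  | nil => simp
  | cons _ _ ih => exact ih
  | pair hm hB hab hw ih =>
    have hb := hB.trans (WithBot.coe_lt_coe.2 hab)
    simp only [Finset.mem_insert, forall_eq_or_imp]
    exact ⟨hB, hb, fun k hk => hb.trans (ih k hk)⟩

theorem le_or_mem_pairs (h : IsNormalSuffix m B w J) : ∀ z ∈ w, m ≤ z ∨ z ∈ J := by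
  induction h with
  | nil => simp
  | cons hm _ ih =>
    simp only [List.mem_cons, forall_eq_or_imp]
    exact ⟨.inl hm, fun z hz => (ih z hz).imp_left hm.trans⟩
  | pair hm hB hab hw ih =>
    simp only [List.mem_cons, forall_eq_or_imp, Finset.mem_insert]
    exact ⟨.inl hm.le, .inr (.inl trivial), fun z hz => (ih z hz).imp hm.le.trans (.inr ∘ .inr)⟩

theorem le_of_mem (h : IsNormalSuffix m m w J) {z : X} (hz : z ∈ w) : m ≤ z :=
  (h.le_or_mem_pairs z hz).elim id fun hJ => (h.lt_of_mem_pairs z hJ).le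

/-- A letter that is smaller than an earlier letter of the non-decreasing word is the smallest
letter that remains, and the other letters of the remaining pairs are new. -/
theorem of_mem_of_lt (h : IsNormalSuffix m B w J) {x : X} (hx : x ∈ w) (hxm : (x : WithBot X) < m) :
    x ∈ J ∧ (∀ k ∈ J, k ≠ x → m < k) ∧ ∀ z ∈ w.erase x, x < z := by
  induction h with
  | nil => simp at hx
  | @cons m B y w J hm hw ih =>
    have hxy := WithBot.coe_lt_coe.1 (hxm.trans_le hm)
    obtain ⟨h1, h2, h3⟩ := ih ((List.mem_cons.1 hx).resolve_left hxy.ne) (hxm.trans_le hm)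
    refine ⟨h1, fun k hk hkx => hm.trans_lt (h2 k hk hkx), ?_⟩
    rw [List.erase_cons_tail (by simpa using hxy.ne')]
    simpa using ⟨hxy, h3⟩
  | @pair m B a b w J hm hB hab hw ih =>
    have hxb := WithBot.coe_lt_coe.1 (hxm.trans hm)
    have hle : ∀ z ∈ w, b ≤ z := fun z hz => WithBot.coe_le_coe.1 (hw.le_of_mem hz)
    obtain rfl : x = a := by
      simp only [List.mem_cons] at hx
      rcases hx with rfl | rfl | hx
      · exact absurd hxb (lt_irrefl _)
      · rfl
      · exact absurd (hle x hx) hxb.not_ge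
    refine ⟨by simp, ?_, ?_⟩
    · simp only [Finset.mem_insert, forall_eq_or_imp]
      exact ⟨fun h => absurd rfl h, fun _ => hm, fun k hk _ => hm.trans (hw.lt_of_mem_pairs k hk)⟩
    · rw [List.erase_cons_tail (by simpa using hab.ne'), List.erase_cons_head]
      simpa using ⟨hab, fun z hz => hab.trans_le (hle z hz)⟩

variable {K : Type*} [Field K]

/-- If the letters that remain are greater than an element `a` of `T` that is not in `S`, then `T` is
not reached from `S`. -/
theorem wordOp_eq_zero_of_forall_lt {T S : Finset X} {F : (X → ℤ) × Finset X → K} {a : X}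
    (hF : ∀ N S, F (N, S) ≠ 0 → S = T) {v : List X} (hv : ∀ z ∈ v, a < z) (haT : a ∈ T)
    (haS : a ∉ S) (N : X → ℤ) : wordOp K T v F (N, S) = 0 := by
  by_contra h
  exact haS ((mem_iff_of_wordOp_ne_zero hF hv h a le_rfl).2 haT)

/-- The functional attached to a normal word does not vanish at it, and vanishes at all the
lexicographically smaller words of the same content. -/
theorem wordOp_apply (h : IsNormalSuffix m B w J) :
    ∀ (T S : Finset X) (N M : X → ℤ) (F : (X → ℤ) × Finset X → K),
      (∀ N S, F (N, S) ≠ 0 → N = M ∧ S = T) → F (M, T) ≠ 0 → B ≤ m → (∀ k : X, m < k → N k = 0) →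
      (∀ k ∈ S, (k : WithBot X) ≤ B) → T = S ∪ J →
      (∀ z, M z = N z + w.count z - if z ∈ J then 1 else 0) →
      wordOp K T w F (N, S) ≠ 0 ∧
        ∀ v : List X, v.Perm w → List.Lex (· < ·) v w → wordOp K T v F (N, S) = 0 := by
  induction h with
  | nil m B =>
    intro T S N M F hF hF0 hBm hN hS hT hM
    have h1 : M = N := funext fun z => by simpa using hM z
    rw [Finset.union_empty] at hT
    subst h1 hT
    rw [wordOp_nil]
    exact ⟨hF0, fun v _ h => by cases h⟩
  | @cons m B y w J hm hw ih =>
    intro T S N M F hF hF0 hBm hN hS hT hM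
    have hF' := fun N S h => (hF N S h).2
    -- No letter greater than `y` is present in `N`, so `y` has no partner.
    have hstep : ∀ v, wordOp K T (y :: v) F (N, S) = wordOp K T v F (N + Pi.single y 1, S) := by
      intro v
      rw [wordOp_cons, letterOp_apply_of_forall]
      exact fun k _ _ hyk => hN k (hm.trans_lt (WithBot.coe_lt_coe.2 hyk))
    obtain ⟨ih1, ih2⟩ := ih T S (N + Pi.single y 1) M F hF hF0 (hBm.trans hm)
      (fun k hk => by
        rw [Pi.add_apply, hN k (hm.trans_lt hk), Pi.single_eq_of_ne (WithBot.coe_lt_coe.1 hk).ne']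
        simp) hS hT
      (fun z => by
        rw [hM z]
        simp only [List.count_cons, Pi.add_apply, Pi.single_apply, beq_iff_eq, eq_comm (a := z)]
        push_cast; ring)
    refine ⟨by rwa [hstep], fun v hvp hv => ?_⟩
    cases hv with
    | nil => exact absurd hvp.length_eq (by simp)
    | cons hv => rw [hstep, ih2 _ (List.perm_cons y |>.1 hvp) hv]
    -- At the first difference, `x` belongs to a pair still to come but finds no partner. The
    -- letters left are all greater than `x`, so nothing can move `x` into the set later.
    | @rel x v y w hxy =>
      have hxw : x ∈ w := (List.mem_cons.1 (hvp.subset List.mem_cons_self)).resolve_left hxy.ne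
      obtain ⟨hxJ, h2, h3⟩ := hw.of_mem_of_lt hxw (WithBot.coe_lt_coe.2 hxy)
      have hBx := hw.lt_of_mem_pairs x hxJ
      rw [wordOp_cons, letterOp_apply_of_forall]
      · refine wordOp_eq_zero_of_forall_lt (a := x) hF' (fun z hz => ?_) (by simp [hT, hxJ])
          (fun hxS => (hS x hxS).not_gt hBx) _
        have : v.Perm (y :: w.erase x) := by
          have := hvp.erase x
          rwa [List.erase_cons_head, List.erase_cons_tail (by simpa using hxy.ne')] at this
        rcases List.mem_cons.1 (this.subset hz) with rfl | hz
        · exact hxy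
        · exact h3 z hz
      · intro k hkT hkS hxk
        rw [hT, Finset.mem_union] at hkT
        exact hN k (hm.trans_lt (h2 k (hkT.resolve_left hkS) hxk.ne'))
  | @pair m B a b w J hm hB hab hw ih =>
    intro T S N M F hF hF0 hBm hN hS hT hM
    have hF' := fun N S h => (hF N S h).2
    have haT : a ∈ T := by simp [hT]
    have hbT : b ∈ T := by simp [hT]
    have haS : a ∉ S := fun h => (hS a h).not_gt hB
    have hbS : b ∉ S := fun h => (hS b h).not_gt (hB.trans (WithBot.coe_lt_coe.2 hab))
    have hle : ∀ z ∈ w, b ≤ z := fun z hz => WithBot.coe_le_coe.1 (hw.le_of_mem hz)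
    have hJ : ∀ k ∈ J, b < k := fun k hk => WithBot.coe_lt_coe.1 (hw.lt_of_mem_pairs k hk)
    have hkT : ∀ k ∈ T, k ∉ S → a < k → b ≤ k := by
      intro k hk hkS hak
      simp only [hT, Finset.mem_union, Finset.mem_insert] at hk
      rcases hk with h | rfl | rfl | h
      · exact absurd h hkS
      · exact absurd hak (lt_irrefl _)
      · exact le_rfl
      · exact (hJ k h).le
    have hstep : ∀ v, wordOp K T (b :: v) F (N, S) = wordOp K T v F (N + Pi.single b 1, S) := by
      intro v
      rw [wordOp_cons, letterOp_apply_of_forall]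
      exact fun k _ _ hyk => hN k (hm.trans (WithBot.coe_lt_coe.2 hyk))
    have hbgt : ∀ k : X, b < k → N k = 0 := fun k hk => hN k (hm.trans (WithBot.coe_lt_coe.2 hk))
    -- After `b a`, either `a` joins the exponent vector, and is then never paired because only
    -- greater letters follow, or it pairs with `b`. Only the second branch survives.
    have hstep2 : ∀ v, (∀ z ∈ v, a < z) → ∃ ε : K, ε ≠ 0 ∧
        wordOp K T (b :: a :: v) F (N, S) = ε * wordOp K T v F (N, insert a (insert b S)) := by
      intro v hv
      obtain ⟨ε, hε, h⟩ := letterOp_apply_of_unique (J := T) (j := a) (b := b) (S := S)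
        (N := N + Pi.single b 1) (wordOp K T v F)
        (fun k hk hkS hak hkb => by
          have := lt_of_le_of_ne (hkT k hk hkS hak) hkb.symm
          rw [Pi.add_apply, hbgt k this, Pi.single_eq_of_ne hkb, add_zero])
        (by simp [hN b hm]) hab hbT haT hbS haS
      refine ⟨ε, hε, ?_⟩
      rw [hstep, wordOp_cons, h, wordOp_eq_zero_of_forall_lt hF' hv haT haS, zero_add,
        add_sub_cancel_right]
    obtain ⟨ih1, ih2⟩ := ih T (insert a (insert b S)) N M F hF hF0 le_rfl
      (fun k hk => hN k (hm.trans hk))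
      (fun k hk => by
        simp only [Finset.mem_insert] at hk
        rcases hk with rfl | rfl | hk
        · exact (WithBot.coe_lt_coe.2 hab).le
        · exact le_rfl
        · exact (hS k hk).trans (hB.trans (WithBot.coe_lt_coe.2 hab)).le)
      (by rw [hT]; ext; simp only [Finset.mem_union, Finset.mem_insert]; tauto)
      (fun z => by
        have haJ : a ∉ J := fun h => (hJ a h).not_gt hab
        have hbJ : b ∉ J := fun h => (hJ b h).false
        rw [hM z]
        simp only [List.count_cons, beq_iff_eq, Finset.mem_insert]
        rcases eq_or_ne z a with rfl | h1
        · simp [haJ, hab.ne']; ring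
        · rcases eq_or_ne z b with rfl | h2
          · simp [hbJ, h1.symm]; ring
          · simp [h1, h2, h1.symm, h2.symm])
    have hwa : ∀ z ∈ w, a < z := fun z hz => hab.trans_le (hle z hz)
    refine ⟨?_, fun v hvp hv => ?_⟩
    · obtain ⟨ε, hε, h⟩ := hstep2 w hwa
      rw [h]
      exact mul_ne_zero hε ih1
    · cases hv with
      | nil => exact absurd hvp.length_eq (by simp)
      | @cons _ v _ hv =>
        replace hvp := List.perm_cons b |>.1 hvp
        cases hv with
        | nil => exact absurd hvp.length_eq (by simp)
        | cons hv =>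
          replace hvp := List.perm_cons a |>.1 hvp
          obtain ⟨ε, hε, h⟩ := hstep2 _ fun z hz => hwa z (hvp.subset hz)
          rw [h, ih2 _ hvp hv, mul_zero]
        | @rel x v _ _ hxa =>
          have : x ∈ w := (List.mem_cons.1 (hvp.subset List.mem_cons_self)).resolve_left hxa.ne
          exact absurd (hle x this) (hxa.trans hab).not_ge
      | @rel x v _ _ hxb =>
        -- The only letter of the word below `b` is `a`. Placed before `b`, it has no partner
        -- available and can never be paired.
        obtain rfl : x = a := by
          have := hvp.subset List.mem_cons_self
          simp only [List.mem_cons] at this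
          rcases this with h | h | h
          · exact absurd h hxb.ne
          · exact h
          · exact absurd (hle x h) hxb.not_ge
        have hvp' : v.Perm (b :: w) := by
          have := hvp.erase x
          rwa [List.erase_cons_head, List.erase_cons_tail (by simpa using hxb.ne'),
            List.erase_cons_head] at this
        rw [wordOp_cons, letterOp_apply_of_forall]
        · refine wordOp_eq_zero_of_forall_lt (a := x) hF' (fun z hz => ?_) haT haS _
          rcases List.mem_cons.1 (hvp'.subset hz) with rfl | hz
          · exact hxb
          · exact hwa z hz
        · exact fun k hk hkS hxk => hN k (hm.trans_le (WithBot.coe_le_coe.2 (hkT k hk hkS hxk)))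

end IsNormalSuffix

/-- `w` contains one of the factors `abc` with `b ≤ a` and `c < a`, or `ba⋯dc` with `a < b`, `c < d`
and `c ≤ b`, where the letters between the two pairs are in non-decreasing order. -/
def HasObstruction (w : List X) : Prop :=
  (∃ p q : List X, ∃ a b c : X, w = p ++ [a, b, c] ++ q ∧ b ≤ a ∧ c < a) ∨
  ∃ p l q : List X, ∃ a b c d : X, w = p ++ (b :: a :: (l ++ [d, c])) ++ q ∧ a < b ∧ c < d ∧ c ≤ b ∧
    l.Pairwise (· ≤ ·)

/-- A suffix of a word without obstructions is the suffix of a normal word. -/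
theorem exists_isNormalSuffix {W : List X} (hW : ¬ HasObstruction W) (n : ℕ) :
    ∀ (w r p : List X) (m B : WithBot X), w.length ≤ n → W = r ++ p ++ w →
      (∀ y ∈ w.head?, m ≤ (y : WithBot X)) →
      (m = B ∨ ∃ (p' : List X) (m₀ : X), p = p' ++ [m₀] ∧ m = (m₀ : WithBot X)) →
      (∀ b : X, B = b → ∃ (a : X) (q : List X), p = b :: a :: q ∧ a < b ∧ q.Pairwise (· ≤ ·) ∧
        ∀ z ∈ q, (z : WithBot X) ≤ m) →
      ∃ J, IsNormalSuffix m B w J := by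
  have h1 := fun h => hW (Or.inl h)
  have h2 := fun h => hW (Or.inr h)
  -- Induction on a length bound, because a pair uses up two letters. The list `p` is the stretch
  -- from the start of the last pair on, and `r` is what precedes it. The alternative `m = B` covers
  -- the start of the word and the position right after a pair, where the last letter read is not
  -- `m`.
  induction n with
  | zero =>
    intro w r p m B hw _ _ _ _
    obtain rfl : w = [] := List.length_eq_zero_iff.1 (Nat.le_zero.1 hw)
    exact ⟨_, .nil _ _⟩
  | succ n ih =>
    intro w r p m B hw hWw hhead hm hB
    match w, hw, hWw, hhead with
    | [], _, _, _ => exact ⟨_, .nil _ _⟩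
    | y :: w, hw, hWw, hhead =>
      have hmy : m ≤ y := hhead y (by simp)
      have hmain : (∀ z ∈ w.head?, y ≤ z) → ∃ J, IsNormalSuffix m B (y :: w) J := by
        intro hz
        obtain ⟨J, hJ⟩ := ih w r (p ++ [y]) y B (by simpa using hw) (by simp [hWw])
          (fun z hzw => WithBot.coe_le_coe.2 (hz z hzw)) (.inr ⟨p, y, rfl, rfl⟩) (by
            intro b hb
            obtain ⟨a, q, rfl, hab, hq, hqm⟩ := hB b hb
            have hqy : ∀ z ∈ q, z ≤ y := fun z hz => WithBot.coe_le_coe.1 ((hqm z hz).trans hmy)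
            refine ⟨a, q ++ [y], by simp, hab, ?_, ?_⟩
            · exact List.pairwise_append.2 ⟨hq, by simp, by simpa using hqy⟩
            · simpa [or_imp, forall_and] using hqy)
        exact ⟨J, .cons hmy hJ⟩
      match w, hw, hWw, hmain with
      | [], _, _, hmain => exact hmain (by simp)
      | z :: w, hw, hWw, hmain =>
        by_cases hyz : y ≤ z
        · exact hmain (by simpa using hyz)
        push Not at hyz
        -- Otherwise the previous pair `b a`, the non-decreasing `q` and the descent `y z` form an
        -- obstruction of the second kind.
        have hBz : B < z := by
          match B, hB with
          | ⊥, _ => exact WithBot.bot_lt_coe z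
          | (b : X), hB =>
            obtain ⟨a, q, rfl, hab, hq, hqm⟩ := hB b rfl
            by_contra hbz
            exact h2 ⟨r, q, w, a, b, z, y, by simp [hWw], hab, hyz,
              not_lt.1 fun h => hbz (WithBot.coe_lt_coe.2 h), hq⟩
        -- If `y` repeated the preceding letter `m₀`, then `m₀ m₀ z` would be an obstruction of the
        -- first kind.
        have hmy' : m < y := by
          rcases hm with rfl | ⟨p', m₀, rfl, rfl⟩
          · exact hBz.trans (WithBot.coe_lt_coe.2 hyz)
          · refine lt_of_le_of_ne hmy fun h => ?_
            obtain rfl := WithBot.coe_inj.1 h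
            exact h1 ⟨r ++ p', w, m₀, m₀, z, by simp [hWw], le_rfl, hyz⟩
        obtain ⟨J, hJ⟩ := ih w (r ++ p) [y, z] y y (by simp at hw; omega) (by simp [hWw])
          (fun c hc => by
            by_contra hcy
            rw [WithBot.coe_le_coe, not_le] at hcy
            obtain ⟨w', rfl⟩ : ∃ w', w = c :: w' := by
              cases w with
              | nil => simp at hc
              | cons c' w' => exact ⟨w', by simp at hc; rw [hc]⟩
            exact h1 ⟨r ++ p, w', y, z, c, by simp [hWw], hyz.le, hcy⟩)
          (.inl rfl) (fun b hb => ⟨z, [], by rw [WithBot.coe_inj.1 hb], by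
            rwa [← WithBot.coe_inj.1 hb], by simp, by simp⟩)
        exact ⟨_, .pair hmy' hBz hyz hJ⟩

theorem exists_isNormalSuffix_bot {w : List X} (hw : ¬ HasObstruction w) :
    ∃ J, IsNormalSuffix ⊥ ⊥ w J :=
  exists_isNormalSuffix hw _ w [] [] ⊥ ⊥ le_rfl (by simp) (by simp) (.inl rfl)
    fun _ h => (WithBot.bot_ne_coe h).elim

/-- The functional that detects a word `w` without obstructions: it vanishes on the T-ideal and at
all smaller words, but not at `w`. -/
theorem exists_functional (K : Type*) [Field K] {w : List X} (hw : ¬ HasObstruction w) :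
    ∃ (J : Finset X) (ev : Module.End K ((X → ℤ) × Finset X → K) →ₗ[K] K), ev (wordOp K J w) ≠ 0 ∧
      ∀ v : List X, List.Shortlex (fun a b : X => a < b) v w → ev (wordOp K J v) = 0 := by
  obtain ⟨J, hJ⟩ := exists_isNormalSuffix_bot hw
  classical
  -- The target configuration: the letters of the pairs have moved to `J`, the rest of the content
  -- stays in the exponent vector. The functional reads off the passage from `(0, ∅)` to `(M, J)`.
  let M : X → ℤ := fun z => w.count z - if z ∈ J then 1 else 0
  let F : (X → ℤ) × Finset X → K := Pi.single (M, J) 1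
  have hF : ∀ N S, F (N, S) ≠ 0 → N = M ∧ S = J := fun N S h => by
    by_contra hne
    exact h (Pi.single_eq_of_ne (fun h => hne (Prod.mk.inj h)) _)
  obtain ⟨h1, h2⟩ := hJ.wordOp_apply (K := K) J ∅ 0 M F hF (by simp [F]) le_rfl (by simp) (by simp)
    (by simp) (by simp [M])
  refine ⟨J, (LinearMap.proj ((0 : X → ℤ), (∅ : Finset X))).comp (LinearMap.applyₗ F), h1,
    fun v hv => ?_⟩
  by_contra hne
  have hcount := content_of_wordOp_ne_zero hF hne
  have hperm : v.Perm w := List.perm_iff_count.2 fun z => by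
    have := hcount z
    simp only [M, Pi.zero_apply, Finset.notMem_empty, if_false] at this
    omega
  exact hne (h2 v hperm ((List.shortlex_iff_lex hperm.length_eq).1 hv))

end NormalWords

/-! ### Leading words of `T` and of the substituted generators -/

section LeadingWords

variable {K X : Type*} [Field K]

/-- The monomial of a word. -/
noncomputable def mono (K : Type*) [Field K] (l : List X) : FreeAlgebra K X :=
  (l.map (FreeAlgebra.ι K)).prod

theorem mono_cons (x : X) (l : List X) : mono K (x :: l) = FreeAlgebra.ι K x * mono K l := by
  simp [mono]

theorem equivMonoidAlgebraFreeMonoid_mono (l : List X) :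
    FreeAlgebra.equivMonoidAlgebraFreeMonoid (mono K l) =
      MonoidAlgebra.single (FreeMonoid.ofList l) 1 := by
  induction l with
  | nil => simp [mono, MonoidAlgebra.one_def]
  | cons x l ih =>
    rw [mono_cons, map_mul, ih]
    simp [FreeAlgebra.equivMonoidAlgebraFreeMonoid, MonoidAlgebra.single_mul_single]

theorem words_mono (l : List X) : words (mono K l) = {FreeMonoid.ofList l} := by
  rw [words, equivMonoidAlgebraFreeMonoid_mono, MonoidAlgebra.coeff_single,
    Finsupp.support_single _ one_ne_zero]

theorem words_neg (f : FreeAlgebra K X) : words (-f) = words f := by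
  simp [words]

theorem words_eq_empty {f : FreeAlgebra K X} : words f = ∅ ↔ f = 0 := by
  simp [words]

theorem mem_words_add {f g : FreeAlgebra K X} {v : FreeMonoid X} (h : v ∈ words (f + g)) :
    v ∈ words f ∨ v ∈ words g := by
  classical
  simp only [words, map_add, MonoidAlgebra.coeff_add] at h ⊢
  exact Finset.mem_union.1 (Finsupp.support_add h)

/-- A polynomial is the linear combination of its words. -/
theorem eq_sum_words (f : FreeAlgebra K X) : f = ∑ v ∈ words f,
    (FreeAlgebra.equivMonoidAlgebraFreeMonoid f).coeff v • mono K v.toList := by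
  apply FreeAlgebra.equivMonoidAlgebraFreeMonoid.injective
  rw [map_sum]
  simp only [map_smul, equivMonoidAlgebraFreeMonoid_mono, FreeMonoid.ofList_toList]
  conv_lhs => rw [← MonoidAlgebra.sum_coeff_single (FreeAlgebra.equivMonoidAlgebraFreeMonoid f)]
  simp [Finsupp.sum, words]

variable [LinearOrder X]

/-- All the words of `f` are smaller than `w`. -/
def WordsBelow (w : List X) (f : FreeAlgebra K X) : Prop :=
  ∀ v ∈ words f, DegLex v (FreeMonoid.ofList w)

namespace WordsBelow

variable {w : List X} {f g : FreeAlgebra K X}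

theorem add (hf : WordsBelow w f) (hg : WordsBelow w g) : WordsBelow w (f + g) := fun v hv =>
  (mem_words_add hv).elim (hf v) (hg v)

theorem neg (hf : WordsBelow w f) : WordsBelow w (-f) := by
  rwa [WordsBelow, words_neg]

theorem sub (hf : WordsBelow w f) (hg : WordsBelow w g) : WordsBelow w (f - g) := by
  rw [sub_eq_add_neg]; exact hf.add hg.neg

end WordsBelow

theorem wordsBelow_mono {v w : List X} (hl : v.length = w.length)
    (h : List.Lex (· < ·) v w) : WordsBelow w (mono K v) := by
  intro u hu
  rw [words_mono, Finset.mem_singleton] at hu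
  rw [hu]
  exact List.Shortlex.of_lex hl h

theorem not_degLex_self (w : FreeMonoid X) : ¬ DegLex w w := fun h =>
  Std.Asymm.asymm (r := List.Shortlex fun a b : X => a < b) _ _ h h

theorem isLeadingWord_mono_add {w : List X} {f : FreeAlgebra K X} (hf : WordsBelow w f) :
    IsLeadingWord DegLex (mono K w + f) (FreeMonoid.ofList w) := by
  refine ⟨?_, fun v hv hvw => ?_⟩
  · have h0 : (FreeAlgebra.equivMonoidAlgebraFreeMonoid f).coeff (FreeMonoid.ofList w) = 0 := by
      by_contra h
      exact not_degLex_self _ (hf _ (Finsupp.mem_support_iff.2 h))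
    rw [words, map_add, equivMonoidAlgebraFreeMonoid_mono, Finsupp.mem_support_iff,
      MonoidAlgebra.coeff_add, Finsupp.add_apply, h0, MonoidAlgebra.coeff_single]
    simp
  · rcases mem_words_add hv with h | h
    · rw [words_mono, Finset.mem_singleton] at h
      exact absurd h hvw
    · exact hf v h

theorem IsLeadingWord.neg {f : FreeAlgebra K X} {w : FreeMonoid X}
    (h : IsLeadingWord DegLex f w) : IsLeadingWord DegLex (-f) w := by
  rwa [IsLeadingWord, words_neg]

theorem degLex_trans {u v w : FreeMonoid X} (h1 : DegLex u v) (h2 : DegLex v w) : DegLex u w := by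
  unfold DegLex at *
  rw [List.shortlex_def] at *
  rcases h1 with h1 | ⟨h1, h1'⟩ <;> rcases h2 with h2 | ⟨h2, h2'⟩
  · exact .inl (h1.trans h2)
  · exact .inl (h2 ▸ h1)
  · exact .inl (h1 ▸ h2)
  · exact .inr ⟨h1.trans h2, List.lt_trans h1' h2'⟩

/-- A nonzero polynomial has a leading word. -/
theorem exists_isLeadingWord {f : FreeAlgebra K X} (hf : f ≠ 0) :
    ∃ w, IsLeadingWord DegLex f w := by
  have hne : (words f).Nonempty := Finset.nonempty_iff_ne_empty.2 fun h => hf (words_eq_empty.1 h)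
  unfold IsLeadingWord
  generalize words f = s at hne
  induction hne using Finset.Nonempty.cons_induction with
  | singleton a => exact ⟨a, by simp⟩
  | cons a s ha _ ih =>
    obtain ⟨w, hw, hws⟩ := ih
    have htri : DegLex a w ∨ a = w ∨ DegLex w a := by
      by_contra! h
      exact h.2.1 (Std.Trichotomous.trichotomous (r := List.Shortlex fun a b : X => a < b) _ _
        h.1 h.2.2)
    rcases htri with h | rfl | h
    · refine ⟨w, by simp [hw], ?_⟩
      simp only [Finset.mem_cons, forall_eq_or_imp]
      exact ⟨fun _ => h, hws⟩
    · exact absurd hw ha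
    · refine ⟨a, by simp, ?_⟩
      simp only [Finset.mem_cons, forall_eq_or_imp]
      refine ⟨fun h => absurd rfl h, fun v hv _ => ?_⟩
      by_cases hvw : v = w
      · exact hvw ▸ h
      · exact degLex_trans (hws v hv hvw) h

/-- The leading word of an element of the T-ideal has an obstruction. -/
theorem hasObstruction_of_isLeadingWord {y₁ y₂ y₃ f : FreeAlgebra K X}
    (hf : f ∈ tIdeal {tripleComm y₁ y₂ y₃}) {w : FreeMonoid X} (hw : IsLeadingWord DegLex f w) :
    HasObstruction w.toList := by
  by_contra hobs
  obtain ⟨J, ev, hev, hlt⟩ := exists_functional K hobs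
  -- The representation satisfies the triple commutator identity, so it kills `T`; applying the
  -- functional to `f` leaves only the contribution of `w`, which is nonzero.
  have hker : tIdeal {tripleComm y₁ y₂ y₃} ≤
      TwoSidedIdeal.ker (FreeAlgebra.lift K (letterOp K J)) := by
    refine TwoSidedIdeal.span_le.2 ?_
    rintro _ ⟨φ, -, _, rfl, rfl⟩
    rw [SetLike.mem_coe, TwoSidedIdeal.mem_ker, tripleComm]
    have : φ ⁅⁅y₁, y₂⁆, y₃⁆ = ⁅⁅φ y₁, φ y₂⁆, φ y₃⁆ := by simp [Ring.lie_def]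
    rw [this, lift_letterOp_lie_lie]
  have h0 := (TwoSidedIdeal.mem_ker _).1 (hker hf)
  have hmono : ∀ l, FreeAlgebra.lift K (letterOp K J) (mono K l) = wordOp K J l := by
    intro l
    rw [mono, map_list_prod, wordOp, List.map_map]
    refine congrArg (fun F => (List.map F l).prod) (funext fun x => ?_)
    exact FreeAlgebra.lift_ι_apply _ _
  let lam : FreeAlgebra K X →ₗ[K] K := ev.comp (FreeAlgebra.lift K (letterOp K J)).toLinearMap
  have hlam : ∀ l, lam (mono K l) = ev (wordOp K J l) := fun l => congrArg ev (hmono l)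
  have h1 : lam f = 0 := (congrArg ev h0).trans (map_zero ev)
  rw [eq_sum_words f, map_sum, Finset.sum_eq_single_of_mem w hw.1 fun v hv hvw => by
    rw [map_smul, hlam, hlt _ (hw.2 v hv hvw), smul_zero], map_smul, hlam] at h1
  exact (mul_ne_zero (Finsupp.mem_support_iff.1 hw.1) hev) h1

theorem lie_lie_expand {A : Type*} [Ring A] (a b c : A) :
    ⁅⁅b, a⁆, c⁆ = -(a * (b * c) + (-(b * (a * c)) + c * (b * a) - c * (a * b))) := by
  simp only [Ring.lie_def]
  noncomm_ring

omit [LinearOrder X] in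
theorem neg_tripleComm (y₁ y₂ y₃ : FreeAlgebra K X) :
    -tripleComm y₁ y₂ y₃ = tripleComm y₂ y₁ y₃ := by
  simp only [tripleComm, lie_lie_expand]
  abel

theorem lie_mul_mul_lie_expand {A : Type*} [Ring A] (a b c d m : A) :
    ⁅a, b⁆ * m * ⁅c, d⁆ = b * (a * (m * (d * c))) + (a * (b * (m * (c * d))) -
      a * (b * (m * (d * c))) - b * (a * (m * (c * d)))) := by
  simp only [Ring.lie_def]
  noncomm_ring

theorem exists_isLeadingWord_tripleComm {a b c : X} (hba : b ≤ a) (hca : c < a) :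
    ∃ y₁ y₂ y₃ : X, IsLeadingWord DegLex
      (tripleComm (FreeAlgebra.ι K y₁) (FreeAlgebra.ι K y₂) (FreeAlgebra.ι K y₃))
      (FreeMonoid.ofList [a, b, c]) := by
  rcases hba.lt_or_eq with hba | rfl
  · refine ⟨b, a, c, ?_⟩
    have h : tripleComm (FreeAlgebra.ι K b) (FreeAlgebra.ι K a) (FreeAlgebra.ι K c) =
        -(mono K [a, b, c] + (-mono K [b, a, c] + mono K [c, b, a] - mono K [c, a, b])) := by
      simp only [tripleComm, mono, List.map_cons, List.map_nil, List.prod_cons, List.prod_nil,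
        mul_one, lie_lie_expand]
    rw [h]
    refine IsLeadingWord.neg (isLeadingWord_mono_add (((wordsBelow_mono (by simp) ?_).neg.add
      (wordsBelow_mono (by simp) ?_)).sub (wordsBelow_mono (by simp) ?_)))
    exacts [.rel hba, .rel hca, .rel hca]
  -- For equal letters `[[c, b], b]` is used; the coefficient 2 falls on `b c b`, so the leading
  -- coefficient stays 1.
  · refine ⟨c, b, b, ?_⟩
    have h : tripleComm (FreeAlgebra.ι K c) (FreeAlgebra.ι K b) (FreeAlgebra.ι K b) =
        mono K [b, b, c] + (mono K [c, b, b] - mono K [b, c, b] - mono K [b, c, b]) := by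
      simp only [tripleComm, mono, List.map_cons, List.map_nil, List.prod_cons, List.prod_nil,
        mul_one, lie_lie_expand]
      abel
    rw [h]
    refine isLeadingWord_mono_add (((wordsBelow_mono (by simp) ?_).sub
      (wordsBelow_mono (by simp) ?_)).sub (wordsBelow_mono (by simp) ?_))
    exacts [.rel hca, .cons (.rel hca), .cons (.rel hca)]

theorem exists_isLeadingWord_latyshevPoly {a b c d : X} (l : List X) (hab : a < b) (hcd : c < d)
    (hcb : c ≤ b) : ∃ y₁ y₂ y₃ y₄ : X, IsLeadingWord DegLex
      (latyshevPoly (FreeAlgebra.ι K y₁) (FreeAlgebra.ι K y₂) (FreeAlgebra.ι K y₃)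
        (FreeAlgebra.ι K y₄) (mono K l)) (FreeMonoid.ofList (b :: a :: (l ++ [d, c]))) := by
  rcases hcb.lt_or_eq with hcb | rfl
  · refine ⟨a, b, c, d, ?_⟩
    have h : latyshevPoly (FreeAlgebra.ι K a) (FreeAlgebra.ι K b) (FreeAlgebra.ι K c)
        (FreeAlgebra.ι K d) (mono K l) =
        mono K (b :: a :: (l ++ [d, c])) + (mono K (a :: b :: (l ++ [c, d])) -
          mono K (a :: b :: (l ++ [d, c])) - mono K (b :: a :: (l ++ [c, d])) +
          mono K (a :: c :: (l ++ [b, d])) - mono K (a :: c :: (l ++ [d, b])) -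
          mono K (c :: a :: (l ++ [b, d])) + mono K (c :: a :: (l ++ [d, b]))) := by
      simp only [latyshevPoly, mono, List.map_cons, List.map_nil, List.prod_cons,
        List.prod_nil, List.map_append, List.prod_append, mul_one, lie_mul_mul_lie_expand]
      abel
    rw [h]
    refine isLeadingWord_mono_add (((((((wordsBelow_mono (by simp) ?_).sub
      (wordsBelow_mono (by simp) ?_)).sub (wordsBelow_mono (by simp) ?_)).add
      (wordsBelow_mono (by simp) ?_)).sub (wordsBelow_mono (by simp) ?_)).sub
      (wordsBelow_mono (by simp) ?_)).add (wordsBelow_mono (by simp) ?_))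
    exacts [.rel hab, .rel hab, .cons (.cons (List.Lex.append_left _ (.rel hcd) _)), .rel hab,
      .rel hab, .rel hcb, .rel hcb]
  -- Here the first summand vanishes as `[c, c] = 0`, and `[c, a] m [c, d]` alone has the required
  -- leading word.
  · refine ⟨c, c, a, d, ?_⟩
    have h : latyshevPoly (FreeAlgebra.ι K c) (FreeAlgebra.ι K c) (FreeAlgebra.ι K a)
        (FreeAlgebra.ι K d) (mono K l) =
        -(mono K (c :: a :: (l ++ [d, c])) + (mono K (a :: c :: (l ++ [c, d])) -
          mono K (a :: c :: (l ++ [d, c])) - mono K (c :: a :: (l ++ [c, d])))) := by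
      simp only [latyshevPoly, mono, List.map_cons, List.map_nil, List.prod_cons,
        List.prod_nil, List.map_append, List.prod_append, mul_one, lie_mul_mul_lie_expand]
      abel
    rw [h]
    refine IsLeadingWord.neg (isLeadingWord_mono_add (((wordsBelow_mono (by simp) ?_).sub
      (wordsBelow_mono (by simp) ?_)).sub (wordsBelow_mono (by simp) ?_)))
    exacts [.rel hab, .rel hab, .cons (.cons (List.Lex.append_left _ (.rel hcd) _))]

end LeadingWords

/-! ### Membership in `T`, substitutions from `S`, and minimality -/

section TIdeal

variable {K X : Type*} [Field K]

theorem lie_lie_mem_tIdeal {x : Fin 5 → X} (hx : Function.Injective x) (f g h : FreeAlgebra K X) :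
    ⁅⁅f, g⁆, h⁆ ∈ tIdeal {tripleComm (FreeAlgebra.ι K (x 0)) (FreeAlgebra.ι K (x 1))
      (FreeAlgebra.ι K (x 2))} := by
  refine TwoSidedIdeal.subset_span ⟨FreeAlgebra.lift K (Function.extend x ![f, g, h, 0, 0] 0),
    trivial, _, rfl, ?_⟩
  simp [tripleComm, Ring.lie_def, hx.extend_apply]

/-- Commutators are central modulo `T`, so `y₅` moves to the left. Expanding `[[y₁, y₂ * y₃], y₄]`
by the Leibniz rule gives `[y₁, y₂] [y₃, y₄] + [y₂, y₄] [y₁, y₃]` modulo `T`, and the two factors of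
the last product commute modulo `T`. -/
theorem latyshevPoly_mem_tIdeal {x : Fin 5 → X} (hx : Function.Injective x)
    (y₁ y₂ y₃ y₄ y₅ : FreeAlgebra K X) : latyshevPoly y₁ y₂ y₃ y₄ y₅ ∈
      tIdeal {tripleComm (FreeAlgebra.ι K (x 0)) (FreeAlgebra.ι K (x 1))
        (FreeAlgebra.ι K (x 2))} := by
  set T := tIdeal {tripleComm (FreeAlgebra.ι K (x 0)) (FreeAlgebra.ι K (x 1))
        (FreeAlgebra.ι K (x 2))} with hT
  have hmem : ∀ f g h, ⁅⁅f, g⁆, h⁆ ∈ T := fun f g h => lie_lie_mem_tIdeal hx f g h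
  have h : latyshevPoly y₁ y₂ y₃ y₄ y₅ =
      ⁅⁅y₁, y₂⁆, y₅⁆ * ⁅y₃, y₄⁆ + ⁅⁅y₁, y₃⁆, y₅⁆ * ⁅y₂, y₄⁆ +
      y₅ * (⁅⁅y₁, y₂ * y₃⁆, y₄⁆ - ⁅⁅y₁, y₂⁆, y₄⁆ * y₃ - y₂ * ⁅⁅y₁, y₃⁆, y₄⁆ +
        ⁅⁅y₁, y₃⁆, ⁅y₂, y₄⁆⁆) := by
    simp only [latyshevPoly, Ring.lie_def]
    noncomm_ring
  rw [h]
  exact T.add_mem (T.add_mem (T.mul_mem_right _ _ (hmem _ _ _)) (T.mul_mem_right _ _ (hmem _ _ _)))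
    (T.mul_mem_left _ _ (T.add_mem (T.sub_mem (T.sub_mem (hmem _ _ _)
      (T.mul_mem_right _ _ (hmem _ _ _))) (T.mul_mem_left _ _ (hmem _ _ _))) (hmem _ _ _)))

variable [LinearOrder X]

/-- All substitutions of letters and an ordered monomial belong to the semigroup. -/
theorem exists_mem_grassmannSemigroup {x : Fin 5 → X} (hx : Function.Injective x)
    (y₁ y₂ y₃ y₄ : X) {l : List X} (hl : l.Pairwise (· ≤ ·)) : ∃ φ ∈ grassmannSemigroup K x,
      φ (FreeAlgebra.ι K (x 0)) = FreeAlgebra.ι K y₁ ∧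
      φ (FreeAlgebra.ι K (x 1)) = FreeAlgebra.ι K y₂ ∧
      φ (FreeAlgebra.ι K (x 2)) = FreeAlgebra.ι K y₃ ∧
      φ (FreeAlgebra.ι K (x 3)) = FreeAlgebra.ι K y₄ ∧
      φ (FreeAlgebra.ι K (x 4)) = mono K l := by
  have h : ∀ i, FreeAlgebra.lift K (Function.extend x ![FreeAlgebra.ι K y₁, FreeAlgebra.ι K y₂,
      FreeAlgebra.ι K y₃, FreeAlgebra.ι K y₄, mono K l] 0) (FreeAlgebra.ι K (x i)) =
      ![FreeAlgebra.ι K y₁, FreeAlgebra.ι K y₂, FreeAlgebra.ι K y₃, FreeAlgebra.ι K y₄,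
        mono K l] i := fun i => by
    rw [FreeAlgebra.lift_ι_apply, hx.extend_apply]
  refine ⟨_, Submonoid.subset_closure ⟨fun i hi => ?_, ?_⟩, h 0, h 1, h 2, h 3, h 4⟩
  -- The last entry is a filler, since `i ≠ 4`.
  · refine ⟨![y₁, y₂, y₃, y₄, y₁] i, ?_⟩
    rw [h]
    fin_cases i <;> first | rfl | exact absurd rfl hi
  · exact ⟨l, hl, h 4⟩

theorem tripleComm_mem_endImage {x : Fin 5 → X} (hx : Function.Injective x) (y₁ y₂ y₃ : X)
    {G : Set (FreeAlgebra K X)} (hG : tripleComm (FreeAlgebra.ι K (x 0)) (FreeAlgebra.ι K (x 1))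
      (FreeAlgebra.ι K (x 2)) ∈ G) :
    tripleComm (FreeAlgebra.ι K y₁) (FreeAlgebra.ι K y₂) (FreeAlgebra.ι K y₃) ∈
      endImage (grassmannSemigroup K x) G := by
  obtain ⟨φ, hφ, h0, h1, h2, -, -⟩ :=
    exists_mem_grassmannSemigroup (K := K) hx y₁ y₂ y₃ y₁ (l := []) (by simp)
  exact ⟨φ, hφ, _, hG, by simp [tripleComm, Ring.lie_def, h0, h1, h2]⟩

theorem latyshevPoly_mem_endImage {x : Fin 5 → X} (hx : Function.Injective x) (y₁ y₂ y₃ y₄ : X)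
    {l : List X} (hl : l.Pairwise (· ≤ ·)) {G : Set (FreeAlgebra K X)}
    (hG : latyshevPoly (FreeAlgebra.ι K (x 0)) (FreeAlgebra.ι K (x 1)) (FreeAlgebra.ι K (x 2))
      (FreeAlgebra.ι K (x 3)) (FreeAlgebra.ι K (x 4)) ∈ G) :
    latyshevPoly (FreeAlgebra.ι K y₁) (FreeAlgebra.ι K y₂) (FreeAlgebra.ι K y₃)
      (FreeAlgebra.ι K y₄) (mono K l) ∈ endImage (grassmannSemigroup K x) G := by
  obtain ⟨φ, hφ, h0, h1, h2, h3, h4⟩ :=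
    exists_mem_grassmannSemigroup (K := K) hx y₁ y₂ y₃ y₄ hl
  exact ⟨φ, hφ, _, hG, by simp [latyshevPoly, Ring.lie_def, h0, h1, h2, h3, h4]⟩

/-- If a set contains `g` and `-g ≠ g` with `g ≠ 0`, then it is not a minimal Gröbner basis. -/
theorem not_isMinimalGroebnerBasis_of_neg_mem {I : TwoSidedIdeal (FreeAlgebra K X)}
    {G : Set (FreeAlgebra K X)} {g : FreeAlgebra K X} (hg : g ∈ G) (hg' : -g ∈ G) (hne : -g ≠ g) :
    ¬ IsMinimalGroebnerBasis DegLex I G := by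
  rintro ⟨hG, hmin⟩
  refine hmin g hg ⟨fun h hh => hG.1 h hh.1, fun f hf hf0 => ?_⟩
  obtain ⟨h, hh, u, v, hu, hv, huv⟩ := hG.2 f hf hf0
  by_cases hhg : h = g
  · exact ⟨-g, ⟨hg', hne⟩, u, v, (hhg ▸ hu).neg, hv, huv⟩
  · exact ⟨h, ⟨hh, hhg⟩, u, v, hu, hv, huv⟩

end TIdeal

end GroebnerS

/-! ### The theorem -/

open GroebnerS in
theorem theorem4p3 {K X : Type*} [Field K] (hK : ringChar K ≠ 2)
    [LinearOrder X] [WellFoundedLT X] (x : Fin 5 ≤i X)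
    (z : Fin 5 → FreeAlgebra K X) (hz : ∀ i, z i = FreeAlgebra.ι K (x i))
    (S : Submonoid (FreeAlgebra K X →ₐ[K] FreeAlgebra K X))
    (hS : S = GroebnerS.grassmannSemigroup K x)
    (T : TwoSidedIdeal (FreeAlgebra K X))
    (hT : T = GroebnerS.tIdeal {GroebnerS.tripleComm (z 0) (z 1) (z 2)})
    (G : Set (FreeAlgebra K X))
    (hG : G = {GroebnerS.tripleComm (z 0) (z 1) (z 2),
      GroebnerS.latyshevPoly (z 0) (z 1) (z 2) (z 3) (z 4)}) :
    GroebnerS.IsGroebnerSBasis GroebnerS.DegLex S T G ∧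
      ¬ GroebnerS.IsMinimalGroebnerBasis GroebnerS.DegLex T (GroebnerS.endImage S G \ {0}) := by
  have hx : Function.Injective x := x.injective
  simp only [hz] at hT hG
  have hGT : ∀ g ∈ G, g ∈ T := by
    rw [hG, hT]
    rintro g (rfl | rfl)
    · exact subset_tIdeal _ _ rfl
    · exact latyshevPoly_mem_tIdeal hx _ _ _ _ _
  have hST : IsSIdeal S T := fun φ _ f hf => by
    rw [hT] at hf ⊢
    exact isSIdeal_tIdeal _ φ trivial f hf
  have hG1 : tripleComm (FreeAlgebra.ι K (x 0)) (FreeAlgebra.ι K (x 1)) (FreeAlgebra.ι K (x 2)) ∈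
    G := by simp [hG]
  have hG2 : latyshevPoly (FreeAlgebra.ι K (x 0)) (FreeAlgebra.ι K (x 1)) (FreeAlgebra.ι K (x 2))
    (FreeAlgebra.ι K (x 3)) (FreeAlgebra.ι K (x 4)) ∈ G := by simp [hG]
  refine ⟨⟨hST, hGT, ?_, fun f hf hf0 => ?_⟩, ?_⟩
  · rintro _ ⟨φ, hφ, g, hg, rfl⟩
    exact hST φ hφ g (hGT g hg)
  · obtain ⟨v, hv⟩ := exists_isLeadingWord hf0
    rw [hT] at hf
    rw [hS]
    rcases hasObstruction_of_isLeadingWord hf hv with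
      ⟨p, q, a, b, c, hvw, hba, hca⟩ | ⟨p, l, q, a, b, c, d, hvw, hab, hcd, hcb, hl⟩
    · obtain ⟨y₁, y₂, y₃, h⟩ := exists_isLeadingWord_tripleComm (K := K) hba hca
      exact ⟨_, tripleComm_mem_endImage hx y₁ y₂ y₃ hG1, _, v, h, hv, FreeMonoid.ofList p,
        FreeMonoid.ofList q, hvw⟩
    · obtain ⟨y₁, y₂, y₃, y₄, h⟩ := exists_isLeadingWord_latyshevPoly (K := K) l hab hcd hcb
      exact ⟨_, latyshevPoly_mem_endImage hx y₁ y₂ y₃ y₄ hl hG2, _, v, h, hv,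
        FreeMonoid.ofList p, FreeMonoid.ofList q, hvw⟩
  -- A substituted triple commutator `g` with leading word `x₂ x₁ x₁` is nonzero. Swapping its first
  -- two letters gives `-g`, with the same leading word and distinct from `g` because the
  -- characteristic is not 2; so `g` is redundant.
  · obtain ⟨y₁, y₂, y₃, h⟩ := exists_isLeadingWord_tripleComm (K := K)
      (a := x 1) (b := x 0) (c := x 0) (x.monotone (by decide)) (x.strictMono (by decide))
    set g := tripleComm (FreeAlgebra.ι K y₁) (FreeAlgebra.ι K y₂) (FreeAlgebra.ι K y₃) with hg
    have hg0 : g ≠ 0 := fun h0 => by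
      have := h.1
      rw [words_eq_empty.2 h0] at this
      simp at this
    refine not_isMinimalGroebnerBasis_of_neg_mem (g := g) ⟨?_, hg0⟩ ⟨?_, by simpa using hg0⟩ ?_
    · rw [hS]; exact tripleComm_mem_endImage hx _ _ _ hG1
    · rw [hS, hg, neg_tripleComm]; exact tripleComm_mem_endImage hx _ _ _ hG1
    · intro h
      have h2 : (2 : K) • g = 0 := by
        rw [two_smul]; nth_rewrite 1 [← h]; exact neg_add_cancel g
      exact (smul_eq_zero.1 h2).elim (Ring.two_ne_zero hK) hg0
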